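/- For $n\ge 0$ let $S_n$ be the set of permutations of $\{1,\dots,n\}$, written as words $\pi=\pi_1\pi_2\cdots\pi_n$. A permutation $\pi\in S_n$ contains a pattern $\tau\in S_k$ if there are indices $i_1<\cdots<i_k$ such that $\pi_{i_1}\cdots\pi_{i_k}$ has the same relative order as $\tau_1\cdots\tau_k$; otherwise $\pi$ avoids $\tau$. For a set $T$ of patterns let $S_n(T)$ be the set of permutations in $S_n$ that avoid every pattern in $T$, and let $F_T(x)=\sum_{n\ge 0}|S_n(T)|\,x^n$. Theorem. Let $T=\{3412,3421,1342\}$. Then, as formal power series, \[ F_T(x)=\frac{2-11x+13x^2-6x^3+(1-x)\,x\,(1-6x+4x^2)\,(1-4x)^{-1/2}}{2\,(1-6x+8x^2-4x^3)}. \] -/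

import Mathlib

/-- The permutation `π`, read as the word `π 0, π 1, …, π (n - 1)`, contains the pattern `τ` (a word
of length `k`): some subsequence of `π` of length `k` has its entries in the same relative order
as the letters of `τ`. -/
def ContainsPattern {k n : ℕ} (τ : Fin k → ℕ) (π : Equiv.Perm (Fin n)) : Prop :=
  ∃ f : Fin k → Fin n, StrictMono f ∧ ∀ i j : Fin k, π (f i) < π (f j) ↔ τ i < τ j

/-- `S_n(T)`: the permutations of size `n` that contain no pattern of the set `T`. -/
def avoiders {k : ℕ} (T : Set (Fin k → ℕ)) (n : ℕ) : Set (Equiv.Perm (Fin n)) :=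
  {π | ∀ τ ∈ T, ¬ ContainsPattern τ π}

/-- The ordinary generating function `F_T(x) = ∑_{n ≥ 0} |S_n(T)| x^n`, as a formal power series. -/
noncomputable def avoidersGF {k : ℕ} (T : Set (Fin k → ℕ)) : PowerSeries ℚ :=
  PowerSeries.mk fun n => ((avoiders T n).ncard : ℚ)

/-- The formal power series `(1 - 4x)^(-1/2)`, that is, the binomial series `(1 + y)^(-1/2)` at
`y = -4x`. -/
noncomputable def invSqrtOneSubFourX : PowerSeries ℚ :=
  PowerSeries.rescale (-4 : ℚ) (PowerSeries.binomialSeries ℚ (-1 / 2 : ℚ))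

/-!
Put a new first letter `h` in front of a shorter avoider, letting the old letters, counted from `0`,
make room for it. The letter `h` is allowed, a *site*, if no letter `≥ h` precedes two letters `< h`
(otherwise `3412` or `3421` arises) and the letters `≥ h` avoid `231` (otherwise `1342` arises).
In the resulting generating tree, putting a site `h ≥ 2` in front destroys the sites from `2` to
`h - 1` and moves each site from `h` on up by one. Whether `0` and `1` are sites is controlled by a
finite phase, and by one bit for each of the other sites, telling whether its use creates a `231`
without the letter `0`. So the tree below a word depends only on its phase and on this list of bits.

The generating function of a subtree satisfies `G = 1 + X * ∑ G'`, the sum running over the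
children. This system has only one solution, and it is found explicitly. The Catalan generating
function enters because putting `1` in front of a word adds one site, which leads to the equation
`c = 1 + X * c ^ 2`.
-/

namespace TripleAvoiders

section Series

open PowerSeries

theorem eq_mk_of_forall_eq_C_add_X_mul {R : Type*} [Semiring R] {a : ℕ → R} {G : ℕ → R⟦X⟧}
    (hG : ∀ n, G n = C (a n) + X * G (n + 1)) (n : ℕ) : G n = mk fun d => a (d + n) := by
  ext d
  induction d generalizing n with
  | zero => simp [hG n]
  | succ d ih => simp [hG n, coeff_succ_X_mul, ih, add_assoc, add_comm 1 n]

/-- The generating function of the Catalan numbers, over `ℚ`. -/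
noncomputable def catalanGF : ℚ⟦X⟧ := catalanSeries.map (Nat.castRingHom ℚ)

lemma X_mul_catalanGF_sq : X * catalanGF ^ 2 = catalanGF - 1 := by
  have h := congrArg (PowerSeries.map (Nat.castRingHom ℚ)) catalanSeries_sq_mul_X_add_one
  simp only [map_add, map_mul, map_pow, map_one, map_X] at h
  linear_combination (norm := (unfold catalanGF; ring)) h

lemma binomialSeries_neg_half_sq_mul :
    PowerSeries.binomialSeries ℚ (-1 / 2 : ℚ) ^ 2 * (1 + X) = 1 := by
  have h_one : (1 + X : ℚ⟦X⟧) = PowerSeries.binomialSeries ℚ (1 : ℚ) := by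
    simpa using (binomialSeries_nat (R := ℚ) (A := ℚ) 1).symm
  rw [h_one, sq, ← binomialSeries_add, ← binomialSeries_add]
  norm_num

lemma invSqrtOneSubFourX_sq_mul : invSqrtOneSubFourX ^ 2 * (1 - 4 * X) = 1 := by
  have h := congrArg (rescale (-4 : ℚ)) binomialSeries_neg_half_sq_mul
  simp only [map_mul, map_pow, map_add, map_one, rescale_X, map_neg, map_ofNat] at h
  linear_combination (norm := (unfold invSqrtOneSubFourX; ring)) h

lemma constantCoeff_invSqrtOneSubFourX : constantCoeff invSqrtOneSubFourX = 1 := by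
  rw [← coeff_zero_eq_constantCoeff_apply, invSqrtOneSubFourX, coeff_rescale]
  simp

lemma invSqrtOneSubFourX_mul_one_sub : invSqrtOneSubFourX * (1 - 2 * X * catalanGF) = 1 := by
  have h_sq : (invSqrtOneSubFourX * (1 - 2 * X * catalanGF)) ^ 2 = 1 := by
    linear_combination invSqrtOneSubFourX_sq_mul +
      4 * X * invSqrtOneSubFourX ^ 2 * X_mul_catalanGF_sq
  refine (sq_eq_one_iff.1 h_sq).resolve_right fun h_neg => ?_
  have h := congrArg constantCoeff h_neg
  norm_num [constantCoeff_invSqrtOneSubFourX] at h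

lemma inv_one_sub_X_mul : (1 - X : ℚ⟦X⟧)⁻¹ * (1 - X) = 1 :=
  PowerSeries.inv_mul_cancel _ (by simp)

/-- The inverse of the factor `1 - 2x(1 - x)C(x)` of `4x³ - 8x² + 6x - 1`, with `C` the Catalan
generating function; the other factor is the image of this one under `C ↦ 1/x - C`. -/
noncomputable def kernelInv : ℚ⟦X⟧ := (1 - 2 * X * (1 - X) * catalanGF)⁻¹

lemma kernelInv_mul : kernelInv * (1 - 2 * X * (1 - X) * catalanGF) = 1 :=
  PowerSeries.inv_mul_cancel _ (by simp)

lemma catalanGF_sq_add_eq_invSqrt : catalanGF ^ 2 + X ^ 2 * catalanGF ^ 4 * invSqrtOneSubFourX =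
    invSqrtOneSubFourX := by
  linear_combination (invSqrtOneSubFourX * (X * catalanGF ^ 2 + catalanGF - 1)
    - 2 * catalanGF * invSqrtOneSubFourX) * X_mul_catalanGF_sq
    - catalanGF ^ 2 * invSqrtOneSubFourX_mul_one_sub

lemma kernelInv_mul_cubic : kernelInv * (1 - 6 * X + 8 * X ^ 2 - 4 * X ^ 3) =
    1 - 2 * X - 2 * X * (1 - X) * catalanGF := by
  linear_combination (1 - 2 * X - 2 * X * (1 - X) * catalanGF) * kernelInv_mul
    - 4 * X * (1 - X) ^ 2 * kernelInv * X_mul_catalanGF_sq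

lemma X_sq_mul_catalanGF_cube : X ^ 2 * catalanGF ^ 3 = catalanGF - 1 - X * catalanGF := by
  linear_combination (X * catalanGF + 1) * X_mul_catalanGF_sq

lemma X_cube_mul_catalanGF_pow_four :
    X ^ 3 * catalanGF ^ 4 = catalanGF - 1 - 2 * X * catalanGF + X := by
  linear_combination X * catalanGF * X_sq_mul_catalanGF_cube + (1 - X) * X_mul_catalanGF_sq

lemma one_add_X_mul_closed_form :
    (1 + X * (invSqrtOneSubFourX + X ^ 3 * catalanGF ^ 3 * invSqrtOneSubFourX * kernelInv))
        * (2 * (1 - 6 * X + 8 * X ^ 2 - 4 * X ^ 3)) =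
      2 - 11 * X + 13 * X ^ 2 - 6 * X ^ 3
        + (1 - X) * X * (1 - 6 * X + 4 * X ^ 2) * invSqrtOneSubFourX := by
  linear_combination
    2 * X ^ 4 * catalanGF ^ 3 * invSqrtOneSubFourX * kernelInv_mul_cubic
    + 2 * X ^ 2 * (1 - 2 * X) * invSqrtOneSubFourX * X_sq_mul_catalanGF_cube
    - 4 * X ^ 2 * (1 - X) * invSqrtOneSubFourX * X_cube_mul_catalanGF_pow_four
    + X * (1 - X) * (1 - 2 * X) * invSqrtOneSubFourX_mul_one_sub

end Series

section Tree

open PowerSeries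

/-- The kind of a possible new first letter `h ≥ 2` of an avoider. A site is `keeping` if only the
letter `0` is below `h` and preceded by a letter that is at least `h`; then putting `h` in front
creates no `231` among the nonzero letters. Otherwise it is `closing`: once `h` is in front,
neither `0` nor `1` can ever be put in front again. -/
inductive SiteKind
  | keeping
  | closing

/-- What decides whether `0` and `1` can be put in front of a nonempty avoider. In the phases
`zeroHead` and `posHead` the word avoids `231` and both can; its first letter is `0`, respectively
positive. In `oneOpen` the word contains `231`, but only with the letter `0` as the `1`, and only
`1` can be put in front. In `closed` the nonzero letters contain `231`, and neither can. -/
inductive Phase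
  | zeroHead
  | posHead
  | oneOpen
  | closed

/-- The data that determine the shape of the generating tree below a nonempty avoider: its phase
and the kinds of its sites `h ≥ 2`, in increasing order of `h`. -/
abbrev TreeLabel : Type := Phase × List SiteKind

open SiteKind Phase

/-- The phase after a letter `h ≥ 2`, of the given kind, has been put in front. -/
def Phase.afterUpper : Phase → SiteKind → Phase
  | zeroHead, keeping => posHead
  | p, keeping => p
  | _, closing => closed

/-- The labels of the words obtained by putting `0` or `1` in front, in this order. -/
def lowerChildren : TreeLabel → List TreeLabel
  | (zeroHead, w) => [(zeroHead, keeping :: w), (posHead, keeping :: w)]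
  | (posHead, w) => [(zeroHead, closing :: w), (oneOpen, keeping :: w)]
  | (oneOpen, w) => [(oneOpen, keeping :: w)]
  | (closed, _) => []

/-- The labels of the words obtained by putting a site `h ≥ 2` in front: the sites from `2` to
`h - 1` are lost, while every site `k ≥ h` becomes the site `k + 1` of the same kind. -/
def upperChildren (p : Phase) : List SiteKind → List TreeLabel
  | [] => []
  | a :: w => (p.afterUpper a, a :: w) :: upperChildren p w

/-- The labels of all words obtained by putting a new first letter in front of a word. -/
def children (l : TreeLabel) : List TreeLabel :=
  lowerChildren l ++ upperChildren l.1 l.2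

local notation "𝒞" => catalanGF
local notation "𝒮" => invSqrtOneSubFourX
local notation "𝒦" => kernelInv
local notation "𝒢" => (1 - (X : ℚ⟦X⟧))⁻¹

/-- The generating function of the part of the tree below `(oneOpen, w)` where the first new letter
is at least `2`, as shown in `one_add_X_mul_sum_upperChildren_oneOpen`. -/
noncomputable def oneOpenUpper : List SiteKind → ℚ⟦X⟧
  | [] => 1
  | keeping :: w => 𝒞 * oneOpenUpper w
  | closing :: w => oneOpenUpper w + X * 𝒢 ^ (w.length + 1)

/-- The generating function of the part of the tree below `(posHead, w)`, or equally
`(zeroHead, w)`, where the first new letter is at least `2`, as shown in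
`one_add_X_mul_sum_upperChildren_posHead`. -/
noncomputable def posHeadUpper : List SiteKind → ℚ⟦X⟧
  | [] => 1
  | keeping :: w => 𝒞 * (posHeadUpper w + X ^ 2 * 𝒮 * 𝒞 * oneOpenUpper w
      + X ^ 3 * 𝒞 * (1 - 2 * X) * 𝒮 * 𝒦 * 𝒢 ^ (w.length + 1))
  | closing :: w => posHeadUpper w + X * 𝒢 ^ (w.length + 1)

/-- The generating function of the tree below a label, with `X` marking the generation. The
coefficients come from an ansatz linear in `posHeadUpper w`, `oneOpenUpper w` and
`(1 - X) ^ (-w.length)`, where `weight_eq_one_add_X_mul_sum_children` determines them one by one;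
for example, that of `oneOpen` has to satisfy `c = 1 + X * c ^ 2`. -/
noncomputable def weight : TreeLabel → ℚ⟦X⟧
  | (zeroHead, w) => 𝒞 ^ 2 * posHeadUpper w + X ^ 2 * 𝒞 ^ 4 * 𝒮 * oneOpenUpper w
      + X ^ 3 * 𝒞 ^ 3 * 𝒮 * 𝒦 * 𝒢 ^ w.length
  | (posHead, w) => 𝒞 * posHeadUpper w + X * 𝒮 * oneOpenUpper w
      + X ^ 2 * 𝒞 * (1 - 2 * X) * 𝒮 * 𝒦 * 𝒢 ^ w.length
  | (oneOpen, w) => 𝒞 * oneOpenUpper w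
  | (closed, w) => 𝒢 ^ w.length

lemma one_add_X_mul_sum_upperChildren_closed (w : List SiteKind) :
    1 + X * ((upperChildren closed w).map weight).sum = 𝒢 ^ w.length := by
  induction w with
  | nil => simp [upperChildren]
  | cons a w ih =>
    cases a <;>
    · simp only [upperChildren, afterUpper, weight, List.map_cons,
        List.sum_cons, List.length_cons] at ih ⊢
      linear_combination ih - 𝒢 ^ w.length * inv_one_sub_X_mul

lemma one_add_X_mul_sum_upperChildren_oneOpen (w : List SiteKind) :
    1 + X * ((upperChildren oneOpen w).map weight).sum = oneOpenUpper w := by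
  induction w with
  | nil => simp [upperChildren, oneOpenUpper]
  | cons a w ih =>
    cases a <;>
    simp only [upperChildren, afterUpper, weight, List.map_cons,
      List.sum_cons, List.length_cons, oneOpenUpper] at ih ⊢
    · linear_combination ih + oneOpenUpper w * X_mul_catalanGF_sq
    · linear_combination ih

lemma one_add_X_mul_sum_upperChildren_posHead (w : List SiteKind) :
    1 + X * ((upperChildren posHead w).map weight).sum = posHeadUpper w := by
  induction w with
  | nil => simp [upperChildren, posHeadUpper]
  | cons a w ih =>
    cases a <;>
    simp only [upperChildren, afterUpper, weight, List.map_cons,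
      List.sum_cons, List.length_cons, posHeadUpper, oneOpenUpper] at ih ⊢
    · linear_combination ih + (posHeadUpper w + X ^ 2 * 𝒮 * 𝒞 * oneOpenUpper w
        + X ^ 3 * 𝒞 * (1 - 2 * X) * 𝒮 * 𝒦 * 𝒢 ^ (w.length + 1)) * X_mul_catalanGF_sq
    · linear_combination ih

lemma upperChildren_zeroHead (w : List SiteKind) :
    upperChildren zeroHead w = upperChildren posHead w := by
  induction w with
  | nil => rfl
  | cons a w ih => cases a <;> simp only [upperChildren, afterUpper, ih]

lemma weight_zeroHead (w : List SiteKind) : weight (zeroHead, w) = posHeadUpper w +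
    X * (weight (zeroHead, keeping :: w) + weight (posHead, keeping :: w)) := by
  simp only [weight, posHeadUpper, oneOpenUpper, List.length_cons]
  linear_combination
    -(𝒞 + 1) * (posHeadUpper w + X ^ 2 * 𝒮 * 𝒞 * oneOpenUpper w
      + X ^ 3 * 𝒞 * (1 - 2 * X) * 𝒮 * 𝒦 * 𝒢 ^ (w.length + 1)) * X_mul_catalanGF_sq
    - X ^ 2 * 𝒮 * 𝒞 ^ 3 * oneOpenUpper w * X_mul_catalanGF_sq
    - X ^ 3 * 𝒞 ^ 3 * 𝒮 * 𝒦 * 𝒢 ^ w.length * inv_one_sub_X_mul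

lemma weight_posHead (w : List SiteKind) : weight (posHead, w) = posHeadUpper w +
    X * (weight (zeroHead, closing :: w) + weight (oneOpen, keeping :: w)) := by
  simp only [weight, posHeadUpper, oneOpenUpper, List.length_cons]
  linear_combination
    - posHeadUpper w * X_mul_catalanGF_sq
    - X * oneOpenUpper w * catalanGF_sq_add_eq_invSqrt
    - X ^ 2 * 𝒢 ^ (w.length + 1) * catalanGF_sq_add_eq_invSqrt
    + X ^ 2 * 𝒮 * 𝒢 ^ (w.length + 1) * kernelInv_mul
    - X ^ 2 * 𝒮 * 𝒦 * 𝒢 ^ (w.length + 1) * X_sq_mul_catalanGF_cube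
    - X ^ 2 * 𝒞 * (1 - 2 * X) * 𝒮 * 𝒦 * 𝒢 ^ w.length * inv_one_sub_X_mul

lemma weight_oneOpen (w : List SiteKind) : weight (oneOpen, w) = oneOpenUpper w +
    X * weight (oneOpen, keeping :: w) := by
  simp only [weight, oneOpenUpper]
  linear_combination -oneOpenUpper w * X_mul_catalanGF_sq

theorem weight_eq_one_add_X_mul_sum_children (l : TreeLabel) :
    weight l = 1 + X * ((children l).map weight).sum := by
  obtain ⟨p, w⟩ := l
  cases p <;>
  simp only [children, lowerChildren, upperChildren_zeroHead, List.map_append, List.map_cons,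
    List.map_nil, List.sum_append, List.sum_cons, List.sum_nil]
  · linear_combination weight_zeroHead w - one_add_X_mul_sum_upperChildren_posHead w
  · linear_combination weight_posHead w - one_add_X_mul_sum_upperChildren_posHead w
  · linear_combination weight_oneOpen w - one_add_X_mul_sum_upperChildren_oneOpen w
  · simp only [weight]
    linear_combination -one_add_X_mul_sum_upperChildren_closed w

lemma weight_zeroHead_nil : weight (.zeroHead, []) = invSqrtOneSubFourX
    + X ^ 3 * catalanGF ^ 3 * invSqrtOneSubFourX * kernelInv := by
  simp only [weight, posHeadUpper, oneOpenUpper, List.length_nil]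
  linear_combination catalanGF_sq_add_eq_invSqrt

end Tree

section Words

/-- The letter that `x` becomes when a new letter `h` enters the word: letters from `h` on move up
by one. -/
def bump (h x : ℕ) : ℕ := if x < h then x else x + 1

section Bump

variable {h k x y : ℕ}

lemma bump_lt_bump_iff : bump h x < bump h y ↔ x < y := by
  unfold bump; split_ifs <;> omega

lemma bump_lt_iff : bump h x < h ↔ x < h := by
  unfold bump; split_ifs <;> omega

lemma lt_bump_iff : h < bump h x ↔ h ≤ x := by
  unfold bump; split_ifs <;> omega

lemma succ_le_bump_iff (hk : h ≤ k) : k + 1 ≤ bump h x ↔ k ≤ x := by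
  unfold bump; split_ifs <;> omega

lemma bump_lt_succ_iff (hk : h ≤ k) : bump h x < k + 1 ↔ x < k := by
  rw [← not_le, succ_le_bump_iff hk, not_le]

lemma bump_eq_zero_iff (hh : 1 ≤ h) : bump h x = 0 ↔ x = 0 := by
  unfold bump; grind

end Bump

/-- The word `g` with a new first letter `h`, the old letters making room for it. Words are
functions to `ℕ`, so that letters of words of different lengths can be compared. -/
def prepend (h : ℕ) {n : ℕ} (g : Fin n → ℕ) : Fin (n + 1) → ℕ := Fin.cons h fun i => bump h (g i)

@[simp] lemma prepend_zero (h : ℕ) {n : ℕ} (g : Fin n → ℕ) : prepend h g 0 = h := rfl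

@[simp] lemma prepend_succ (h : ℕ) {n : ℕ} (g : Fin n → ℕ) (i : Fin n) :
    prepend h g i.succ = bump h (g i) := rfl

/-- Avoidance of `3412`, `3421` and `1342` by a word without repetitions. The first conjunct takes
care of `3412` and `3421` together, the last two letters being left unordered. -/
def AvoidsTriple {n : ℕ} (g : Fin n → ℕ) : Prop :=
  ∀ i j k l, i < j → j < k → k < l →
    ¬ (g k < g i ∧ g l < g i ∧ g i < g j) ∧ ¬ (g i < g l ∧ g l < g j ∧ g j < g k)

/-- No letter which is at least `h` precedes two letters below `h`: a new first letter `h` does not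
play the `3` of `3412` or `3421`. -/
def AtMostOneBelow {n : ℕ} (g : Fin n → ℕ) (h : ℕ) : Prop :=
  ∀ j k l, j < k → k < l → ¬ (h ≤ g j ∧ g k < h ∧ g l < h)

/-- The letters which are at least `h` avoid `231`: a new first letter `h` does not play the `1` of
`1342`. -/
def Avoids231From {n : ℕ} (g : Fin n → ℕ) (h : ℕ) : Prop :=
  ∀ j k l, j < k → k < l → ¬ (h ≤ g l ∧ g l < g j ∧ g j < g k)

/-- The value `h` can be put in front of an avoider so that the result is again an avoider. -/
def IsSite {n : ℕ} (g : Fin n → ℕ) (h : ℕ) : Prop :=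
  AtMostOneBelow g h ∧ Avoids231From g h

/-- No letter below `h` is preceded by a letter which is at least `h`: a new first letter `h` does
not play the `2` of `231`. -/
def NoneBelow {n : ℕ} (g : Fin n → ℕ) (h : ℕ) : Prop :=
  ∀ j k, j < k → ¬ (h ≤ g j ∧ g k < h)

/-- As `NoneBelow`, but with the letter `0` exempt: a new first letter `h` does not play the `2` of
a `231` of nonzero letters. -/
def OnlyZeroBelow {n : ℕ} (g : Fin n → ℕ) (h : ℕ) : Prop :=
  ∀ j k, j < k → h ≤ g j → g k < h → g k = 0

section Prepend

variable {n : ℕ} {g : Fin n → ℕ} {c h k : ℕ}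

lemma avoidsTriple_prepend_iff : AvoidsTriple (prepend h g) ↔ AvoidsTriple g ∧ IsSite g h := by
  simp only [AvoidsTriple, IsSite, AtMostOneBelow, Avoids231From, Fin.forall_fin_succ,
    prepend_zero, prepend_succ, bump_lt_bump_iff, bump_lt_iff, lt_bump_iff, Fin.succ_lt_succ_iff,
    Fin.not_lt_zero, Fin.succ_pos, false_imp_iff, true_imp_iff, implies_true, true_and]
  grind

lemma avoids231From_prepend_iff : Avoids231From (prepend h g) c ↔
    (∀ k l, k < l → ¬ (c ≤ bump h (g l) ∧ g l < h ∧ h ≤ g k)) ∧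
    ∀ j k l, j < k → k < l → ¬ (c ≤ bump h (g l) ∧ g l < g j ∧ g j < g k) := by
  simp only [Avoids231From, Fin.forall_fin_succ, prepend_zero, prepend_succ, bump_lt_bump_iff,
    bump_lt_iff, lt_bump_iff, Fin.succ_lt_succ_iff, Fin.not_lt_zero, Fin.succ_pos, false_imp_iff,
    true_imp_iff, implies_true, true_and]

lemma avoids231From_zero_prepend_iff :
    Avoids231From (prepend h g) 0 ↔ Avoids231From g 0 ∧ NoneBelow g h := by
  rw [avoids231From_prepend_iff]
  simp only [Avoids231From, NoneBelow, Nat.zero_le, true_and]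
  grind

lemma avoids231From_one_prepend_iff (hh : 1 ≤ h) :
    Avoids231From (prepend h g) 1 ↔ Avoids231From g 1 ∧ OnlyZeroBelow g h := by
  rw [avoids231From_prepend_iff]
  simp only [Avoids231From, OnlyZeroBelow, Nat.one_le_iff_ne_zero, ne_eq, bump_eq_zero_iff hh]
  grind

lemma atMostOneBelow_succ_prepend_iff (hk : h ≤ k) :
    AtMostOneBelow (prepend h g) (k + 1) ↔ AtMostOneBelow g k := by
  simp only [AtMostOneBelow, Fin.forall_fin_succ, prepend_zero, prepend_succ, succ_le_bump_iff hk,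
    bump_lt_succ_iff hk, Fin.succ_lt_succ_iff, Fin.not_lt_zero, false_imp_iff, implies_true,
    true_and, (Nat.lt_succ_of_le hk).not_ge, false_and, not_false_eq_true]

lemma avoids231From_succ_prepend_iff (hk : h ≤ k) :
    Avoids231From (prepend h g) (k + 1) ↔ Avoids231From g k := by
  rw [avoids231From_prepend_iff]
  simp only [Avoids231From, succ_le_bump_iff hk]
  refine and_iff_right fun k l _ => ?_
  omega

lemma isSite_succ_prepend_iff_of_le (hk : h ≤ k) :
    IsSite (prepend h g) (k + 1) ↔ IsSite g k :=
  and_congr (atMostOneBelow_succ_prepend_iff hk) (avoids231From_succ_prepend_iff hk)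

lemma onlyZeroBelow_succ_prepend_iff (hh : 1 ≤ h) (hk : h ≤ k) :
    OnlyZeroBelow (prepend h g) (k + 1) ↔ OnlyZeroBelow g k := by
  simp only [OnlyZeroBelow, Fin.forall_fin_succ, prepend_zero, prepend_succ, succ_le_bump_iff hk,
    bump_lt_succ_iff hk, bump_eq_zero_iff hh, Fin.succ_lt_succ_iff, Fin.not_lt_zero, false_imp_iff,
    implies_true, true_and, (Nat.lt_succ_of_le hk).not_ge]

lemma onlyZeroBelow_succ_prepend_zero_iff :
    OnlyZeroBelow (prepend 0 g) (k + 1) ↔ NoneBelow g k := by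
  simp only [OnlyZeroBelow, NoneBelow, Fin.forall_fin_succ, bump, prepend_zero, prepend_succ,
    Fin.succ_lt_succ_iff, Nat.not_lt_zero, if_false, Fin.not_lt_zero, false_imp_iff, implies_true,
    true_and, Nat.le_zero, Nat.succ_ne_zero, add_le_add_iff_right, add_lt_add_iff_right, imp_false,
    not_and]

lemma Avoids231From.mono (hg : Avoids231From g c) (hch : c ≤ h) : Avoids231From g h :=
  fun j k l hjk hkl ⟨hl, hlt⟩ => hg j k l hjk hkl ⟨hch.trans hl, hlt⟩

lemma noneBelow_zero : NoneBelow g 0 := fun _ _ _ h => Nat.not_lt_zero _ h.2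

lemma onlyZeroBelow_one : OnlyZeroBelow g 1 := fun _ _ _ _ h => Nat.lt_one_iff.1 h

lemma isSite_zero_iff : IsSite g 0 ↔ Avoids231From g 0 :=
  and_iff_right fun _ _ _ _ _ h => Nat.not_lt_zero _ h.2.1

lemma NoneBelow.onlyZeroBelow (hg : NoneBelow g h) : OnlyZeroBelow g h :=
  fun j k hjk hj hk => (hg j k hjk ⟨hj, hk⟩).elim

end Prepend

/-- The word of a permutation, with natural numbers as letters. -/
def permWord {n : ℕ} (σ : Equiv.Perm (Fin n)) (i : Fin n) : ℕ := σ i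

section PermWord

variable {n : ℕ} (σ : Equiv.Perm (Fin n)) {h k : ℕ}

lemma permWord_injective : Function.Injective (permWord σ) :=
  Fin.val_injective.comp σ.injective

lemma exists_permWord_eq {v : ℕ} (hv : v < n) : ∃ i, permWord σ i = v :=
  ⟨σ.symm ⟨v, hv⟩, by simp [permWord]⟩

lemma isSite_one_permWord_iff : IsSite (permWord σ) 1 ↔ Avoids231From (permWord σ) 1 := by
  refine and_iff_right fun j k l _ hkl h => hkl.ne (permWord_injective σ ?_)
  omega

lemma not_atMostOneBelow_prepend_permWord (hk : 2 ≤ k) (hkh : k ≤ h) (hn : h ≤ n) :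
    ¬ AtMostOneBelow (prepend h (permWord σ)) k := by
  obtain ⟨i, hi⟩ := exists_permWord_eq σ (v := 0) (by omega)
  obtain ⟨j, hj⟩ := exists_permWord_eq σ (v := 1) (by omega)
  have hi' : prepend h (permWord σ) i.succ < k := by
    rw [prepend_succ, hi, bump, if_pos] <;> omega
  have hj' : prepend h (permWord σ) j.succ < k := by
    rw [prepend_succ, hj, bump, if_pos] <;> omega
  have hij : i ≠ j := by rintro rfl; omega
  intro hg
  rcases hij.lt_or_gt with hlt | hlt
  · exact hg 0 i.succ j.succ i.succ_pos (Fin.succ_lt_succ_iff.2 hlt) ⟨hkh, hi', hj'⟩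
  · exact hg 0 j.succ i.succ j.succ_pos (Fin.succ_lt_succ_iff.2 hlt) ⟨hkh, hj', hi'⟩

lemma isSite_succ_prepend_permWord_iff (hk : 1 ≤ k) (hn : h ≤ n) :
    IsSite (prepend h (permWord σ)) (k + 1) ↔ h ≤ k ∧ IsSite (permWord σ) k := by
  by_cases hhk : h ≤ k
  · simp only [isSite_succ_prepend_iff_of_le hhk, hhk, true_and]
  · have := not_atMostOneBelow_prepend_permWord σ (show 2 ≤ k + 1 by omega)
      (show k + 1 ≤ h by omega) hn
    simp only [IsSite, this, hhk, false_and]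

variable {σ} in
lemma noneBelow_permWord_iff_onlyZeroBelow (hσ : Avoids231From (permWord σ) 0) (hh : 2 ≤ h) :
    NoneBelow (permWord σ) h ↔ OnlyZeroBelow (permWord σ) h := by
  refine ⟨NoneBelow.onlyZeroBelow, fun h_zero j k hjk ⟨hj, hk⟩ => ?_⟩
  have hk0 := h_zero j k hjk hj hk
  obtain ⟨i, hi⟩ := exists_permWord_eq σ (v := 1) (by have := (σ j).is_lt; grind [permWord])
  rcases lt_trichotomy i j with hij | rfl | hji
  · exact hσ i j k hij hjk ⟨Nat.zero_le _, by omega, by omega⟩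
  · omega
  · have := h_zero j i hji hj (by omega)
    omega

lemma noneBelow_one_permWord_iff (σ : Equiv.Perm (Fin (n + 1))) :
    NoneBelow (permWord σ) 1 ↔ permWord σ 0 = 0 := by
  constructor
  · intro h_none
    obtain ⟨i, hi⟩ := exists_permWord_eq σ n.succ_pos
    rcases eq_or_ne i 0 with rfl | hi0
    · exact hi
    · have := h_none 0 i (Fin.pos_iff_ne_zero.2 hi0)
      omega
  · rintro h_zero j k hjk ⟨-, hk⟩
    have : k = 0 := permWord_injective σ (by omega)
    exact Fin.not_lt_zero _ (this ▸ hjk)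

end PermWord

end Words

section Labels

open SiteKind Phase

open scoped Classical in
/-- The sites of `g` that are at least `c`, in increasing order. -/
noncomputable def sitesFrom {n : ℕ} (c : ℕ) (g : Fin n → ℕ) : List ℕ :=
  (List.range' c (n + 1 - c)).filter fun h => IsSite g h

open scoped Classical in
/-- The kind of the site `h` of `g`. -/
noncomputable def siteKind {n : ℕ} (g : Fin n → ℕ) (h : ℕ) : SiteKind :=
  if OnlyZeroBelow g h then keeping else closing

open scoped Classical in
/-- The phase of a nonempty word. `Avoids231From g 1` says that the nonzero letters of `g` avoid
`231`. -/
noncomputable def phase {m : ℕ} (g : Fin (m + 1) → ℕ) : Phase :=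
  if Avoids231From g 0 then if g 0 = 0 then zeroHead else posHead
  else if Avoids231From g 1 then oneOpen else closed

/-- The kinds of the sites `h ≥ 2` of a nonempty word, in increasing order of `h`. -/
noncomputable def kinds {m : ℕ} (g : Fin (m + 1) → ℕ) : List SiteKind :=
  (sitesFrom 2 g).map (siteKind g)

/-- The label of a nonempty avoider in the generating tree. -/
noncomputable def label {m : ℕ} (g : Fin (m + 1) → ℕ) : TreeLabel := (phase g, kinds g)

lemma map_afterUpper_eq_upperChildren (p : Phase) (f : ℕ → SiteKind) {l : List ℕ}
    (hl : l.Pairwise (· < ·)) :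
    (l.map fun h => (p.afterUpper (f h), (l.filter (h ≤ ·)).map f)) =
      upperChildren p (l.map f) := by
  induction l with
  | nil => rfl
  | cons a l ih =>
    obtain ⟨ha, hl⟩ := List.pairwise_cons.1 hl
    have h_head : (a :: l).filter (a ≤ ·) = a :: l :=
      List.filter_eq_self.2 (by simpa using fun b hb => (ha b hb).le)
    have h_tail : ∀ h ∈ l, (a :: l).filter (h ≤ ·) = l.filter (h ≤ ·) := fun h hh =>
      List.filter_cons_of_neg (by simpa using ha h hh)
    rw [List.map_cons, List.map_cons, upperChildren, h_head, List.map_cons, ← ih hl]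
    exact congrArg _ (List.map_congr_left fun h hh => by rw [h_tail h hh])

section Word

variable {n : ℕ} {c : ℕ} {g : Fin n → ℕ}

lemma pairwise_sitesFrom : (sitesFrom c g).Pairwise (· < ·) :=
  List.Pairwise.filter _ (List.pairwise_lt_range' _)

lemma mem_sitesFrom {h : ℕ} : h ∈ sitesFrom c g ↔ (c ≤ h ∧ h ≤ n) ∧ IsSite g h := by
  simp only [sitesFrom, List.mem_filter, List.mem_range'_1, decide_eq_true_eq]
  exact and_congr_left fun _ => by omega

lemma sitesFrom_of_isSite (hc : c ≤ n) (hs : IsSite g c) :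
    sitesFrom c g = c :: sitesFrom (c + 1) g := by
  rw [sitesFrom, Nat.sub_add_comm hc, List.range'_succ, List.filter_cons_of_pos (by simpa),
    sitesFrom, Nat.add_sub_add_right]

lemma sitesFrom_of_not_isSite (hc : c ≤ n) (hs : ¬ IsSite g c) :
    sitesFrom c g = sitesFrom (c + 1) g := by
  rw [sitesFrom, Nat.sub_add_comm hc, List.range'_succ, List.filter_cons_of_neg (by simpa),
    sitesFrom, Nat.add_sub_add_right]

lemma siteKind_succ_prepend {h k : ℕ} (hh : 1 ≤ h) (hk : h ≤ k) :
    siteKind (prepend h g) (k + 1) = siteKind g k := by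
  classical
  simp only [siteKind, onlyZeroBelow_succ_prepend_iff hh hk]

end Word

variable {m : ℕ} {σ : Equiv.Perm (Fin (m + 1))} {h : ℕ}

lemma kinds_prepend (hm : h ≤ m + 1) : kinds (prepend h (permWord σ)) =
    ((sitesFrom 1 (permWord σ)).filter (h ≤ ·)).map
      fun k => siteKind (prepend h (permWord σ)) (k + 1) := by
  classical
  have h_range : List.range' 2 (m + 1) = (List.range' 1 (m + 1)).map (· + 1) := by
    simp only [add_comm _ 1, List.map_add_range', Nat.reduceAdd]
  have h_sites : sitesFrom 2 (prepend h (permWord σ)) =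
      ((sitesFrom 1 (permWord σ)).filter (h ≤ ·)).map (· + 1) := by
    rw [sitesFrom, sitesFrom, show m + 1 + 1 + 1 - 2 = m + 1 by rfl, h_range, List.filter_map,
      List.filter_filter]
    refine congrArg _ (List.filter_congr fun k hk => ?_)
    rw [Function.comp_apply, Bool.eq_iff_iff, Bool.and_eq_true, decide_eq_true_iff,
      decide_eq_true_iff, decide_eq_true_iff]
    exact isSite_succ_prepend_permWord_iff σ (List.mem_range'_1.1 hk).1 hm
  simp only [kinds, h_sites, List.map_map, Function.comp_def]

lemma kinds_prepend_of_two_le (hh : 2 ≤ h) (hm : h ≤ m + 1) :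
    kinds (prepend h (permWord σ)) =
      ((sitesFrom 2 (permWord σ)).filter (h ≤ ·)).map (siteKind (permWord σ)) := by
  have h_filter : (sitesFrom 1 (permWord σ)).filter (h ≤ ·) =
      (sitesFrom 2 (permWord σ)).filter (h ≤ ·) := by
    by_cases hs : IsSite (permWord σ) 1
    · rw [sitesFrom_of_isSite (by omega) hs,
        List.filter_cons_of_neg (by simpa using Nat.lt_of_succ_le hh)]
    · rw [sitesFrom_of_not_isSite (by omega) hs]
  rw [kinds_prepend hm, h_filter]
  refine List.map_congr_left fun k hk => siteKind_succ_prepend (by omega) ?_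
  simpa using (List.mem_filter.1 hk).2

lemma kinds_prepend_one (hσ : Avoids231From (permWord σ) 1) :
    kinds (prepend 1 (permWord σ)) = keeping :: kinds (permWord σ) := by
  have h_filter : (sitesFrom 1 (permWord σ)).filter (1 ≤ ·) = sitesFrom 1 (permWord σ) :=
    List.filter_eq_self.2 fun k hk => by simpa using (mem_sitesFrom.1 hk).1.1
  have h_kind : siteKind (permWord σ) 1 = keeping := if_pos onlyZeroBelow_one
  rw [kinds_prepend (by omega), h_filter, List.map_congr_left fun k hk =>
    siteKind_succ_prepend le_rfl (mem_sitesFrom.1 hk).1.1,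
    sitesFrom_of_isSite (by omega) ((isSite_one_permWord_iff σ).2 hσ), List.map_cons, h_kind, kinds]

lemma kinds_prepend_zero (hσ : Avoids231From (permWord σ) 0) :
    kinds (prepend 0 (permWord σ)) =
      (if permWord σ 0 = 0 then keeping else closing) :: kinds (permWord σ) := by
  classical
  have h_filter : (sitesFrom 1 (permWord σ)).filter (0 ≤ ·) = sitesFrom 1 (permWord σ) :=
    List.filter_eq_self.2 fun k _ => by simp
  have h_one : IsSite (permWord σ) 1 := (isSite_one_permWord_iff σ).2 (hσ.mono zero_le_one)
  rw [kinds_prepend (by omega), h_filter, sitesFrom_of_isSite (by omega) h_one, List.map_cons]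
  congr 1
  · simp only [siteKind, onlyZeroBelow_succ_prepend_zero_iff, noneBelow_one_permWord_iff]
  · refine List.map_congr_left fun k hk => ?_
    simp only [siteKind, onlyZeroBelow_succ_prepend_zero_iff,
      noneBelow_permWord_iff_onlyZeroBelow hσ (mem_sitesFrom.1 hk).1.1]

lemma phase_prepend_of_two_le (hh : 2 ≤ h) :
    phase (prepend h (permWord σ)) =
      (phase (permWord σ)).afterUpper (siteKind (permWord σ) h) := by
  classical
  have h_mono : Avoids231From (permWord σ) 0 → Avoids231From (permWord σ) 1 :=
    fun h => h.mono zero_le_one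
  have h_none := @noneBelow_permWord_iff_onlyZeroBelow _ σ h
  simp only [phase, siteKind, avoids231From_zero_prepend_iff,
    avoids231From_one_prepend_iff (show 1 ≤ h by omega), prepend_zero]
  split_ifs <;> grind [Phase.afterUpper]

open scoped Classical in
lemma phase_prepend_one (hσ : Avoids231From (permWord σ) 1) :
    phase (prepend 1 (permWord σ)) =
      if phase (permWord σ) = zeroHead then posHead else oneOpen := by
  simp only [phase, avoids231From_zero_prepend_iff, avoids231From_one_prepend_iff le_rfl,
    noneBelow_one_permWord_iff, onlyZeroBelow_one, prepend_zero]
  grind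

lemma phase_prepend_zero (hσ : Avoids231From (permWord σ) 0) :
    phase (prepend 0 (permWord σ)) = zeroHead := by
  rw [phase, if_pos (avoids231From_zero_prepend_iff.2 ⟨hσ, noneBelow_zero⟩), if_pos]
  exact prepend_zero 0 _

lemma map_label_prepend_sitesFrom_two :
    ((sitesFrom 2 (permWord σ)).map fun h => label (prepend h (permWord σ))) =
      upperChildren (phase (permWord σ)) (kinds (permWord σ)) := by
  rw [kinds, ← map_afterUpper_eq_upperChildren _ _ pairwise_sitesFrom]
  refine List.map_congr_left fun h hh => ?_
  obtain ⟨⟨hh, hm⟩, -⟩ := mem_sitesFrom.1 hh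
  rw [label, phase_prepend_of_two_le hh, kinds_prepend_of_two_le hh hm]

theorem map_label_prepend_sitesFrom_zero (σ : Equiv.Perm (Fin (m + 1))) :
    ((sitesFrom 0 (permWord σ)).map fun h => label (prepend h (permWord σ))) =
      children (label (permWord σ)) := by
  by_cases h_one : Avoids231From (permWord σ) 1
  swap
  · have h_zero : ¬ Avoids231From (permWord σ) 0 := fun h => h_one (h.mono zero_le_one)
    have h_phase : phase (permWord σ) = closed := by simp only [phase, h_zero, h_one, if_false]
    rw [sitesFrom_of_not_isSite (by omega) (isSite_zero_iff.not.2 h_zero),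
      sitesFrom_of_not_isSite (by omega) ((isSite_one_permWord_iff σ).not.2 h_one),
      map_label_prepend_sitesFrom_two, label, children, h_phase]
    rfl
  have h_sites := sitesFrom_of_isSite (by omega) ((isSite_one_permWord_iff σ).2 h_one)
  by_cases h_zero : Avoids231From (permWord σ) 0
  · rw [sitesFrom_of_isSite (by omega) (isSite_zero_iff.2 h_zero), h_sites, List.map_cons,
      List.map_cons, map_label_prepend_sitesFrom_two]
    simp only [label, phase_prepend_zero h_zero, kinds_prepend_zero h_zero,
      phase_prepend_one h_one, kinds_prepend_one h_one]
    by_cases h_head : permWord σ 0 = 0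
    · have h_phase : phase (permWord σ) = zeroHead := by
        simp only [phase, h_zero, h_head, if_true]
      simp only [h_phase, h_head, if_true, children]
      rfl
    · have h_phase : phase (permWord σ) = posHead := by
        simp only [phase, h_zero, h_head, if_true, if_false]
      simp only [h_phase, h_head, if_false, children, reduceCtorEq]
      rfl
  · have h_phase : phase (permWord σ) = oneOpen := by
      simp only [phase, h_zero, h_one, if_true, if_false]
    rw [sitesFrom_of_not_isSite (by omega) (isSite_zero_iff.not.2 h_zero), h_sites,
      List.map_cons, map_label_prepend_sitesFrom_two]
    simp only [label, phase_prepend_one h_one, kinds_prepend_one h_one, h_phase, children,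
      reduceCtorEq, if_false]
    rfl

end Labels

section Permutations

open PowerSeries

/-- The permutation with first value `h` followed by the values of `σ`, in the relative order of
`σ`. -/
noncomputable def consPerm {n : ℕ} (h : Fin (n + 1)) (σ : Equiv.Perm (Fin n)) :
    Equiv.Perm (Fin (n + 1)) :=
  Equiv.ofBijective (Fin.cons h fun i => h.succAbove (σ i)) <| by
    rw [← Finite.injective_iff_bijective, Fin.cons_injective_iff]
    exact ⟨fun ⟨i, hi⟩ => Fin.succAbove_ne _ _ hi,
      Fin.succAbove_right_injective.comp σ.injective⟩

lemma permWord_consPerm {n : ℕ} (h : Fin (n + 1)) (σ : Equiv.Perm (Fin n)) :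
    permWord (consPerm h σ) = prepend h (permWord σ) := by
  funext i
  refine Fin.cases rfl (fun i => ?_) i
  simp only [permWord, consPerm, Equiv.ofBijective_apply, Fin.cons_succ, prepend_succ, bump,
    Fin.succAbove, Fin.lt_def, Fin.val_castSucc]
  split_ifs <;> simp only [Fin.val_castSucc, Fin.val_succ, *, if_true, if_false]

lemma consPerm_bijective (n : ℕ) : Function.Bijective
    fun p : Equiv.Perm (Fin n) × Fin (n + 1) => consPerm p.2 p.1 := by
  rw [Fintype.bijective_iff_injective_and_card]
  constructor
  · rintro ⟨σ, h⟩ ⟨τ, k⟩ h_eq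
    have h_apply : ∀ i, consPerm h σ i = consPerm k τ i := Equiv.congr_fun h_eq
    obtain rfl : h = k := h_apply 0
    congr 1
    ext i
    exact congrArg Fin.val (Fin.succAbove_right_injective (p := h) (h_apply i.succ))
  · simp [Fintype.card_perm, Nat.factorial_succ, mul_comm]

lemma sum_map_sitesFrom_zero {M : Type*} [AddCommMonoid M] {n : ℕ} (g : Fin n → ℕ) (f : ℕ → M)
    [DecidablePred (IsSite g)] :
    ((sitesFrom 0 g).map f).sum = ∑ h : Fin (n + 1), if IsSite g h then f h else 0 := by
  rw [← List.sum_toFinset f (pairwise_sitesFrom.imp Nat.ne_of_lt),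
    Fin.sum_univ_eq_sum_range (fun h => if IsSite g h then f h else 0), ← Finset.sum_filter]
  congr 1
  ext h
  simp [mem_sitesFrom]

open scoped Classical in
lemma sum_avoidsTriple_succ {M : Type*} [AddCommMonoid M] (n : ℕ) (f : (Fin (n + 1) → ℕ) → M) :
    ∑ σ : Equiv.Perm (Fin (n + 1)) with AvoidsTriple (permWord σ), f (permWord σ) =
      ∑ σ : Equiv.Perm (Fin n) with AvoidsTriple (permWord σ),
        ((sitesFrom 0 (permWord σ)).map fun h => f (prepend h (permWord σ))).sum := by
  simp only [Finset.sum_filter, sum_map_sitesFrom_zero]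
  rw [← (consPerm_bijective n).sum_comp, Fintype.sum_prod_type]
  refine Finset.sum_congr rfl fun σ _ => ?_
  simp only [permWord_consPerm, avoidsTriple_prepend_iff]
  split_ifs with hσ <;> simp [hσ]

open scoped Classical in
/-- The generating function, by generation, of the part of the generating tree that starts with the
avoiders of size `n + 1`. -/
noncomputable def levelWeight (n : ℕ) : ℚ⟦X⟧ :=
  ∑ σ : Equiv.Perm (Fin (n + 1)) with AvoidsTriple (permWord σ), weight (label (permWord σ))

open scoped Classical in
lemma levelWeight_eq (n : ℕ) : levelWeight n =
    C ({σ : Equiv.Perm (Fin (n + 1)) | AvoidsTriple (permWord σ)}.ncard : ℚ)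
      + X * levelWeight (n + 1) := by
  have h_weight (σ : Equiv.Perm (Fin (n + 1))) : weight (label (permWord σ)) = 1 + X *
      ((sitesFrom 0 (permWord σ)).map fun h => weight (label (prepend h (permWord σ)))).sum := by
    rw [weight_eq_one_add_X_mul_sum_children, ← map_label_prepend_sitesFrom_zero, List.map_map]
    rfl
  have h_card : {σ : Equiv.Perm (Fin (n + 1)) | AvoidsTriple (permWord σ)}.ncard =
      Finset.card {σ : Equiv.Perm (Fin (n + 1)) | AvoidsTriple (permWord σ)} := by
    rw [Set.ncard_eq_toFinset_card', Set.toFinset_ofPred]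
  rw [levelWeight, levelWeight, sum_avoidsTriple_succ (n + 1) fun g => weight (label g),
    Finset.sum_congr rfl fun σ _ => h_weight σ, Finset.sum_add_distrib, ← Finset.mul_sum,
    Finset.sum_const, h_card, map_natCast, nsmul_one]

lemma levelWeight_zero : levelWeight 0 = weight (.zeroHead, []) := by
  have h_avoids (σ : Equiv.Perm (Fin 1)) : AvoidsTriple (permWord σ) :=
    fun i j _ _ hij => absurd hij (by omega)
  have h_label (σ : Equiv.Perm (Fin 1)) : label (permWord σ) = (.zeroHead, []) := by
    have h231 : Avoids231From (permWord σ) 0 := fun i j _ hij => absurd hij (by omega)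
    simp [label, phase, kinds, sitesFrom, h231, permWord]
  simp [levelWeight, h_avoids, h_label]

end Permutations

section Patterns

lemma containsPattern_fin_four_iff {n : ℕ} {τ : Fin 4 → ℕ} {π : Equiv.Perm (Fin n)} :
    ContainsPattern τ π ↔ ∃ i j k l, i < j ∧ j < k ∧ k < l ∧
      ∀ a b : Fin 4, π (![i, j, k, l] a) < π (![i, j, k, l] b) ↔ τ a < τ b := by
  constructor
  · rintro ⟨f, hf, hπ⟩
    refine ⟨f 0, f 1, f 2, f 3, hf (by decide), hf (by decide), hf (by decide), ?_⟩
    have h_eta : ![f 0, f 1, f 2, f 3] = f := by ext a; fin_cases a <;> rfl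
    simpa only [h_eta]
  · rintro ⟨i, j, k, l, hij, hjk, hkl, hπ⟩
    refine ⟨![i, j, k, l], Fin.strictMono_iff_lt_succ.2 fun a => ?_, hπ⟩
    fin_cases a <;> assumption

variable {n : ℕ} {π : Equiv.Perm (Fin n)}

lemma containsPattern_3412_iff : ContainsPattern ![3, 4, 1, 2] π ↔
    ∃ i j k l, i < j ∧ j < k ∧ k < l ∧ π k < π l ∧ π l < π i ∧ π i < π j := by
  rw [containsPattern_fin_four_iff]
  refine exists₄_congr fun i j k l => and_congr_right' <| and_congr_right' <| and_congr_right' ?_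
  simp only [Fin.forall_fin_succ, IsEmpty.forall_iff, Matrix.cons_val_zero, Matrix.cons_val_succ,
    Matrix.cons_val_fin_one, Nat.reduceLT]
  grind

lemma containsPattern_3421_iff : ContainsPattern ![3, 4, 2, 1] π ↔
    ∃ i j k l, i < j ∧ j < k ∧ k < l ∧ π l < π k ∧ π k < π i ∧ π i < π j := by
  rw [containsPattern_fin_four_iff]
  refine exists₄_congr fun i j k l => and_congr_right' <| and_congr_right' <| and_congr_right' ?_
  simp only [Fin.forall_fin_succ, IsEmpty.forall_iff, Matrix.cons_val_zero, Matrix.cons_val_succ,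
    Matrix.cons_val_fin_one, Nat.reduceLT]
  grind

lemma containsPattern_1342_iff : ContainsPattern ![1, 3, 4, 2] π ↔
    ∃ i j k l, i < j ∧ j < k ∧ k < l ∧ π i < π l ∧ π l < π j ∧ π j < π k := by
  rw [containsPattern_fin_four_iff]
  refine exists₄_congr fun i j k l => and_congr_right' <| and_congr_right' <| and_congr_right' ?_
  simp only [Fin.forall_fin_succ, IsEmpty.forall_iff, Matrix.cons_val_zero, Matrix.cons_val_succ,
    Matrix.cons_val_fin_one, Nat.reduceLT]
  grind

lemma mem_avoiders_iff_avoidsTriple :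
    π ∈ avoiders {![3, 4, 1, 2], ![3, 4, 2, 1], ![1, 3, 4, 2]} n ↔ AvoidsTriple (permWord π) := by
  simp only [avoiders, Set.mem_ofPred_eq, Set.mem_insert_iff, Set.mem_singleton_iff,
    forall_eq_or_imp, forall_eq, containsPattern_3412_iff, containsPattern_3421_iff,
    containsPattern_1342_iff, AvoidsTriple, permWord, Fin.val_fin_lt, not_exists, not_and]
  constructor
  · rintro ⟨h3412, h3421, h1342⟩ i j k l hij hjk hkl
    refine ⟨fun hki hli hij' => ?_, h1342 i j k l hij hjk hkl⟩
    rcases lt_or_gt_of_ne (π.injective.ne hkl.ne) with hlt | hlt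
    · exact h3412 i j k l hij hjk hkl hlt hli hij'
    · exact h3421 i j k l hij hjk hkl hlt hki hij'
  · refine fun h => ⟨fun i j k l hij hjk hkl hkl' hli => ?_, fun i j k l hij hjk hkl hlk hki => ?_,
      fun i j k l hij hjk hkl => (h i j k l hij hjk hkl).2⟩
    · exact (h i j k l hij hjk hkl).1 (hkl'.trans hli) hli
    · exact (h i j k l hij hjk hkl).1 hki (hlk.trans hki)

end Patterns

open PowerSeries in
lemma avoidersGF_eq_one_add_X_mul :
    avoidersGF {![3, 4, 1, 2], ![3, 4, 2, 1], ![1, 3, 4, 2]} = 1 + X * weight (.zeroHead, []) := by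
  have h_avoiders (n : ℕ) : avoiders {![3, 4, 1, 2], ![3, 4, 2, 1], ![1, 3, 4, 2]} n =
      {σ : Equiv.Perm (Fin n) | AvoidsTriple (permWord σ)} :=
    Set.ext fun _ => mem_avoiders_iff_avoidsTriple
  have h_empty : {σ : Equiv.Perm (Fin 0) | AvoidsTriple (permWord σ)} = Set.univ :=
    Set.eq_univ_of_forall fun _ i => i.elim0
  rw [← levelWeight_zero, eq_mk_of_forall_eq_C_add_X_mul levelWeight_eq]
  ext (_ | d)
  · simp [avoidersGF, h_avoiders, h_empty]
  · simp [avoidersGF, h_avoiders, coeff_succ_X_mul, coeff_one]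

end TripleAvoiders

open PowerSeries in
theorem mainTheorem12 :
    avoidersGF {![3, 4, 1, 2], ![3, 4, 2, 1], ![1, 3, 4, 2]} =
      (2 - 11 * X + 13 * X ^ 2 - 6 * X ^ 3
          + (1 - X) * X * (1 - 6 * X + 4 * X ^ 2) * invSqrtOneSubFourX)
        * (2 * (1 - 6 * X + 8 * X ^ 2 - 4 * X ^ 3))⁻¹ := by
  rw [eq_mul_inv_iff_mul_eq (by simp [map_ofNat]), TripleAvoiders.avoidersGF_eq_one_add_X_mul,
    TripleAvoiders.weight_zeroHead_nil, TripleAvoiders.one_add_X_mul_closed_form]
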